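/- Let $T>0$, $d\ge 0$ and $1\le p<\infty$. For $f:[0,T]\to\mathbb R^d$ let $V_p(f)=\sup\sum_{i=1}^n \frac{\|f(t_i)-f(t_{i-1})\|^p}{(t_i-t_{i-1})^{p-1}}$, the supremum being over all partitions $0=t_0<t_1<\dots<t_n=T$, be its Riesz $p$-variation. Let $BV_p(\mathbb R^d)$ be the space of all $f$ with $V_p(f)<\infty$, with the norm $\|f\|_{V_p}=\|f\|_\infty+V_p(f)^{1/p}$, where $\|f\|_\infty=\sup_{t\in[0,T]}\|f(t)\|$. A set $\mathcal R\subset BV_p(\mathbb R^d)$ is called $V_p$-decomposable if for all $f_1,f_2\in\mathcal R$ and all $a\in[0,T]$ the function $$(f_1\oplus_a f_2)(t)=f_1(0)+\int_0^t\big(\mathbf 1_{[0,a)}(s)f_1'(s)+\mathbf 1_{[a,T]}(s)f_2'(s)\big)\,ds,\qquad t\in[0,T],$$ belongs to $\mathcal R$. Let $x_0\in\mathbb R^d$ and let $\mathcal R\subset BV_p(\mathbb R^d)$ satisfy $\{f(0):f\in\mathcal R\}=\{x_0\}$ (in particular, $\mathcal R\neq\emptyset$). If $p=1$, assume in addition that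 every $f\in\mathcal R$ is absolutely continuous. Suppose that $\mathcal R$ is convex, $V_p$-decomposable, bounded in the norm $\|\cdot\|_{V_p}$, and closed in $BV_p(\mathbb R^d)$ with respect to the norm $\|\cdot\|_\infty$. Then $\mathcal R$ is an integral: there is a Borel measurable set-valued function $\Phi$ on $[0,T]$ whose values are nonempty compact convex subsets of $\mathbb R^d$, and which is $p$-integrably bounded (there is $g\in L^p([0,T])$ with $\sup_{x\in\Phi(t)}\|x\|\le g(t)$ for almost every $t$), such that $$\mathcal R=\Big\{f\in BV_p(\mathbb R^d):\ f(t)=x_0+\int_0^t\varphi(s)\,ds\ \text{ for all } t\in[0,T],\ \text{for some } \varphi\in S_{L^p}(\Phi)\Big\},$$ where $S_{L^p}(\Phi)=\{\varphi\in L^p([0,T],\mathbb R^d):\varphi(t)\in\Phi(t)\text{ for a.e. }t\in[0,T]\}$. Here measurability of $\Phi$ means that $\{t\in[0,T]:\Phi(t)\cap U\ne\emptyset\}$ is a Borel set for every open $U\subset\mathbb R^d$. -/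

import Mathlib

open MeasureTheory Set
open scoped ENNReal NNReal

noncomputable section

namespace RieszBV

/-- Lebesgue measure on `[0,T]`. -/
abbrev leb (T : ℝ) : Measure (Icc (0 : ℝ) T) :=
  Measure.comap Subtype.val volume

/-- The Riesz `p`-variation `V_p(f)` of `f : [0,T] → E`: the supremum over all partitions
`0 = t_0 < t_1 < ... < t_n = T` of the sums `∑ d(f(t_{i-1}), f(t_i))^p / (t_i - t_{i-1})^(p-1)`. -/
def variation {T : ℝ} {E : Type*} [MetricSpace E] (p : ℝ) (f : Icc (0 : ℝ) T → E) : ℝ≥0∞ :=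
  ⨆ (n : ℕ) (t : Fin (n + 1) → Icc (0 : ℝ) T)
    (_ : StrictMono t ∧ (t 0 : ℝ) = 0 ∧ (t (Fin.last n) : ℝ) = T),
    ∑ i : Fin n, ENNReal.ofReal
      (dist (f (t i.castSucc)) (f (t i.succ)) ^ p /
        ((t i.succ : ℝ) - (t i.castSucc : ℝ)) ^ (p - 1))

/-- The space `BV_p(E)` of functions `[0,T] → E` of finite Riesz `p`-variation. -/
def BV (T p : ℝ) (E : Type*) [MetricSpace E] : Set (Icc (0 : ℝ) T → E) :=
  {f | variation p f < ∞}

/-- The sup norm on `[0,T]`, with value `∞` for unbounded functions. -/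
def supNorm {T : ℝ} {E : Type*} [NormedAddCommGroup E] (f : Icc (0 : ℝ) T → E) : ℝ≥0∞ :=
  ⨆ t, ‖f t‖ₑ

/-- The norm `‖f‖_∞ + V_p(f)^(1/p)` of `BV_p(E)`. -/
def bvNorm {T : ℝ} {E : Type*} [NormedAddCommGroup E] (p : ℝ) (f : Icc (0 : ℝ) T → E) : ℝ≥0∞ :=
  supNorm f + variation p f ^ (1 / p)

/-- `R` is bounded in the norm of `BV_p(E)`. -/
def IsBoundedBV {T : ℝ} {E : Type*} [NormedAddCommGroup E] (p : ℝ)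
    (R : Set (Icc (0 : ℝ) T → E)) : Prop :=
  ∃ C : ℝ≥0, ∀ f ∈ R, bvNorm p f ≤ C

/-- `R` is closed in `BV_p(E)` with respect to the sup norm: it contains every `f ∈ BV_p(E)` that
is a sup norm limit of elements of `R`. -/
def IsSupClosed {T : ℝ} {E : Type*} [NormedAddCommGroup E] (p : ℝ)
    (R : Set (Icc (0 : ℝ) T → E)) : Prop :=
  ∀ f ∈ BV T p E, (∀ ε : ℝ≥0∞, 0 < ε → ∃ g ∈ R, supNorm (f - g) < ε) → f ∈ R

/-- The derivative `f'` of `f : [0,T] → E` (one-sided at the end points). -/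
def derivative {T : ℝ} (hT : 0 ≤ T) {E : Type*} [NormedAddCommGroup E] [NormedSpace ℝ E]
    (f : Icc (0 : ℝ) T → E) (s : Icc (0 : ℝ) T) : E :=
  derivWithin (IccExtend hT f) (Icc 0 T) s

/-- The integral function `t ↦ ∫_0^t φ(s) ds` on `[0,T]`. -/
def primitive {T : ℝ} {E : Type*} [NormedAddCommGroup E] [NormedSpace ℝ E]
    (φ : Icc (0 : ℝ) T → E) (t : Icc (0 : ℝ) T) : E :=
  ∫ s in Iic t, φ s ∂(leb T)

/-- The function `f₁ ⊕_a f₂`, that is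
`t ↦ f₁(0) + ∫_0^t (1_{[0,a)}(s) f₁'(s) + 1_{[a,T]}(s) f₂'(s)) ds`. -/
def concat {T : ℝ} (hT : 0 ≤ T) {E : Type*} [NormedAddCommGroup E] [NormedSpace ℝ E]
    (a : Icc (0 : ℝ) T) (f₁ f₂ : Icc (0 : ℝ) T → E) (t : Icc (0 : ℝ) T) : E :=
  f₁ ⟨0, left_mem_Icc.2 hT⟩ +
    primitive (fun s => (Iio a).indicator (derivative hT f₁) s +
      (Ici a).indicator (derivative hT f₂) s) t

/-- `V_p`-decomposability of a set of functions. -/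
def IsDecomposable {T : ℝ} (hT : 0 ≤ T) {E : Type*} [NormedAddCommGroup E] [NormedSpace ℝ E]
    (R : Set (Icc (0 : ℝ) T → E)) : Prop :=
  ∀ f₁ ∈ R, ∀ f₂ ∈ R, ∀ a : Icc (0 : ℝ) T, concat hT a f₁ f₂ ∈ R

/-- Absolute continuity of `f : [0,T] → E`. -/
def IsAbsolutelyContinuous {T : ℝ} (hT : 0 ≤ T) {E : Type*} [NormedAddCommGroup E]
    (f : Icc (0 : ℝ) T → E) : Prop :=
  AbsolutelyContinuousOnInterval (IccExtend hT f) 0 T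

/-- `Φ` takes values in `Conv(E)`: nonempty, compact and convex subsets of `E`. -/
def IsConvValued {T : ℝ} {E : Type*} [NormedAddCommGroup E] [NormedSpace ℝ E]
    (Φ : Icc (0 : ℝ) T → Set E) : Prop :=
  ∀ t, (Φ t).Nonempty ∧ IsCompact (Φ t) ∧ Convex ℝ (Φ t)

/-- Measurability of a set-valued function: preimages `{t | Φ(t) ∩ U ≠ ∅}` of open sets `U` are
Borel sets. -/
def IsMeasurableSetValued {T : ℝ} {E : Type*} [NormedAddCommGroup E]
    (Φ : Icc (0 : ℝ) T → Set E) : Prop :=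
  ∀ U : Set E, IsOpen U → MeasurableSet {t | (Φ t ∩ U).Nonempty}

/-- `Φ` is `p`-integrably bounded: there is `g ∈ L^p([0,T])` with `sup_{x ∈ Φ(t)} ‖x‖ ≤ g(t)` for
almost every `t`. -/
def IsIntegrablyBounded {T : ℝ} {E : Type*} [NormedAddCommGroup E] (p : ℝ)
    (Φ : Icc (0 : ℝ) T → Set E) : Prop :=
  ∃ g : Icc (0 : ℝ) T → ℝ, MemLp g (ENNReal.ofReal p) (leb T) ∧
    ∀ᵐ t ∂(leb T), ∀ x ∈ Φ t, ‖x‖ ≤ g t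

/-- The set `S_{L^p}(Φ)` of `L^p`-selections of `Φ`. -/
def selections {T : ℝ} {E : Type*} [NormedAddCommGroup E] (p : ℝ)
    (Φ : Icc (0 : ℝ) T → Set E) :
    Set (Lp E (ENNReal.ofReal p) (leb T)) :=
  {φ | ∀ᵐ t ∂(leb T), φ t ∈ Φ t}

/-- The set `x₀ + ∫ Φ(s) ds` of all `f ∈ BV_p(E)` of the form `f = x₀ + ∫_0^· φ(s) ds` with
`φ ∈ S_{L^p}(Φ)`. -/
def setIntegral {T : ℝ} {E : Type*} [NormedAddCommGroup E] [NormedSpace ℝ E] (p : ℝ) (x₀ : E)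
    (Φ : Icc (0 : ℝ) T → Set E) : Set (Icc (0 : ℝ) T → E) :=
  {f | f ∈ BV T p E ∧ ∃ φ ∈ selections p Φ, ∀ t, f t = x₀ + primitive φ t}

end RieszBV

end

/-! Differentiation identifies `R` with a set `D` of `L^p` functions, `derivativeSet`: those whose
primitive from `x₀` lies in `R`. The dictionary is F. Riesz's theorem. A function of finite
variation is absolutely continuous when `p > 1` (this is assumed when `p = 1`); hence it is the
integral of its derivative, and `∫ ‖f'‖^p ≤ V_p(f)` (`lintegral_derivative_rpow_le`). Conversely,
Hölder's inequality gives the primitive of `φ ∈ L^p` variation at most `∫ ‖φ‖^p`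
(`variation_const_add_primitive_le`).

Thus `D` is convex and bounded in `L^p`. It is closed in `L^p` for `L¹` approximation, because `L¹`
closeness of derivatives forces uniform closeness of primitives. By Lebesgue differentiation,
`V_p`-decomposability of `R` says that `D` is decomposable along the intervals `[0,a)`; these
generate the Borel sets, and closedness carries decomposability to all of them
(`IsL1Closed.decomposableAlong_of_Iio`).

What remains is the Hiai-Umegaki theorem, `exists_setValued_of_decomposable`. Separability of `L¹`
yields a sequence `φ n` in `D` dense enough that `Φ(x) = closure {φ n x}` contains the values of
every element of `D` almost everywhere. Choosing pointwise among `φ 0, …, φ n` stays in `D` by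
decomposability. Choosing the value nearest to a selection of `Φ` approximates it from within `D`;
choosing the value of largest norm shows that `sup ‖φ n‖` is in `L^p`. -/

namespace RieszBV

open Filter Topology

/-! ### Riesz variation and its monotone control -/

/-- The set of Riesz sums of `f` over the partitions of `[0,t]`. -/
def partitionSums {T : ℝ} {E : Type*} [MetricSpace E] (p : ℝ) (f : Icc (0 : ℝ) T → E) (t : ℝ) :
    Set ℝ≥0∞ :=
  {S | ∃ (n : ℕ) (u : Fin (n + 1) → Icc (0 : ℝ) T),
    (StrictMono u ∧ (u 0 : ℝ) = 0 ∧ (u (Fin.last n) : ℝ) = t) ∧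
    S = ∑ i : Fin n, ENNReal.ofReal
      (dist (f (u i.castSucc)) (f (u i.succ)) ^ p /
        ((u i.succ : ℝ) - (u i.castSucc : ℝ)) ^ (p - 1))}

lemma sSup_partitionSums {T : ℝ} {E : Type*} [MetricSpace E] (p : ℝ) (f : Icc (0 : ℝ) T → E) :
    sSup (partitionSums p f T) = variation p f := by
  apply le_antisymm
  · refine sSup_le ?_
    rintro S ⟨n, u, hu, rfl⟩
    exact le_iSup_of_le n (le_iSup_of_le u (le_iSup_of_le hu le_rfl))
  · exact iSup_le fun n => iSup_le fun u => iSup_le fun hu => le_sSup ⟨n, u, hu, rfl⟩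

lemma partitionSums_nonempty {T : ℝ} {E : Type*} [MetricSpace E] (p : ℝ)
    (f : Icc (0 : ℝ) T → E) (t : Icc (0 : ℝ) T) : (partitionSums p f t).Nonempty := by
  rcases t.2.1.eq_or_lt with h | h
  -- At `t = 0` only the one-point partition, with empty sum, is available.
  · exact ⟨_, 0, fun _ => t, ⟨fun i j hij => by omega, h.symm, rfl⟩, rfl⟩
  · refine ⟨_, 1, ![⟨0, le_rfl, t.2.1.trans t.2.2⟩, t], ⟨?_, rfl, rfl⟩, rfl⟩
    rw [Fin.strictMono_iff_lt_succ]
    intro i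
    fin_cases i
    exact h

/-- Appending `b` to a partition of `[0,a]` gives a partition of `[0,b]` with one more term. This
superadditivity is what makes the running variation a control function. -/
lemma sSup_partitionSums_add_le {T : ℝ} {E : Type*} [MetricSpace E] (p : ℝ)
    (f : Icc (0 : ℝ) T → E) {a b : Icc (0 : ℝ) T} (hab : a < b) :
    sSup (partitionSums p f a) +
      ENNReal.ofReal (dist (f a) (f b) ^ p / ((b : ℝ) - a) ^ (p - 1)) ≤
      sSup (partitionSums p f b) := by
  rw [ENNReal.sSup_add (partitionSums_nonempty p f a)]
  refine iSup₂_le ?_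
  rintro S ⟨n, u, ⟨hu, hu0, hul⟩, rfl⟩
  have hua : u (Fin.last n) = a := Subtype.ext hul
  refine le_sSup ⟨n + 1, Fin.snoc (α := fun _ => Icc (0 : ℝ) T) u b, ⟨?_, ?_, ?_⟩, ?_⟩
  · rw [Fin.strictMono_iff_lt_succ]
    intro i
    induction i using Fin.lastCases with
    | last => simpa [hua, Fin.snoc_castSucc] using hab
    | cast i =>
      rw [Fin.succ_castSucc, Fin.snoc_castSucc, Fin.snoc_castSucc]
      exact hu Fin.castSucc_lt_succ
  · have : (0 : Fin (n + 1 + 1)) = Fin.castSucc 0 := rfl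
    rw [this, Fin.snoc_castSucc, hu0]
  · simp
  · rw [Fin.sum_univ_castSucc]
    congr 1
    · refine Finset.sum_congr rfl fun i _ => ?_
      rw [Fin.succ_castSucc, Fin.snoc_castSucc, Fin.snoc_castSucc]
    · simp [Fin.snoc_castSucc, hua]

/-- A function of finite Riesz `p`-variation is controlled by a monotone function. -/
lemma exists_monotoneOn_control {T : ℝ} (hT : 0 ≤ T) {E : Type*} [MetricSpace E] {p : ℝ}
    {f : Icc (0 : ℝ) T → E} (hf : variation p f < ∞) :
    ∃ W : ℝ → ℝ, MonotoneOn W (Icc 0 T) ∧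
      ENNReal.ofReal (W T - W 0) ≤ variation p f ∧
      ∀ a ∈ Icc 0 T, ∀ b ∈ Icc 0 T, a < b →
        dist (IccExtend hT f a) (IccExtend hT f b) ^ p ≤ (W b - W a) * (b - a) ^ (p - 1) := by
  have key : ∀ a ∈ Icc 0 T, ∀ b ∈ Icc 0 T, a < b → sSup (partitionSums p f a) +
      ENNReal.ofReal (dist (IccExtend hT f a) (IccExtend hT f b) ^ p / (b - a) ^ (p - 1)) ≤
      sSup (partitionSums p f b) := by
    intro a ha b hb hab
    rw [IccExtend_of_mem _ _ ha, IccExtend_of_mem _ _ hb]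
    exact sSup_partitionSums_add_le p f (a := ⟨a, ha⟩) (b := ⟨b, hb⟩) hab
  have hle : ∀ a ∈ Icc 0 T, sSup (partitionSums p f a) ≤ variation p f := by
    intro a ha
    rw [← sSup_partitionSums]
    rcases ha.2.eq_or_lt with rfl | h
    · exact le_rfl
    · exact le_self_add.trans (key a ha T (right_mem_Icc.2 hT) h)
  have hfin : ∀ a ∈ Icc 0 T, sSup (partitionSums p f a) ≠ ∞ := fun a ha =>
    ((hle a ha).trans_lt hf).ne
  have hinc : ∀ a ∈ Icc 0 T, ∀ b ∈ Icc 0 T, a < b →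
      dist (IccExtend hT f a) (IccExtend hT f b) ^ p / (b - a) ^ (p - 1) ≤
        (sSup (partitionSums p f b)).toReal - (sSup (partitionSums p f a)).toReal := by
    intro a ha b hb hab
    have h := ENNReal.toReal_mono (hfin b hb) (key a ha b hb hab)
    rw [ENNReal.toReal_add (hfin a ha) ENNReal.ofReal_ne_top, ENNReal.toReal_ofReal
      (div_nonneg (Real.rpow_nonneg dist_nonneg _) (Real.rpow_nonneg (by linarith) _))] at h
    linarith
  -- The control `W t` is the variation of `f` on `[0,t]`.
  refine ⟨fun t => (sSup (partitionSums p f t)).toReal, ?_, ?_, ?_⟩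
  · intro a ha b hb hab
    rcases hab.eq_or_lt with rfl | h
    · exact le_rfl
    · have h1 := hinc a ha b hb h
      have h2 : 0 ≤ dist (IccExtend hT f a) (IccExtend hT f b) ^ p / (b - a) ^ (p - 1) :=
        div_nonneg (Real.rpow_nonneg dist_nonneg _) (Real.rpow_nonneg (by linarith) _)
      simp only
      linarith
  · refine (ENNReal.ofReal_le_ofReal (sub_le_self _ ENNReal.toReal_nonneg)).trans ?_
    exact ENNReal.ofReal_toReal_le.trans (hle T (right_mem_Icc.2 hT))
  · intro a ha b hb hab
    exact (div_le_iff₀ (Real.rpow_pos_of_pos (by linarith) _)).1 (hinc a ha b hb hab)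

/-! ### Absolute continuity and derivative bounds from the control -/

/-- A point common to `(W l, W u]` and `(W l', W u']` forces both `l` and `l'` below both `u` and
`u'`, by monotonicity; then `min u u'` is common to the source intervals. -/
lemma pairwiseDisjoint_uIoc_comp {W : ℝ → ℝ} {s : Set ℝ} (hW : MonotoneOn W s) {ι : Type*}
    {t : Set ι} {I : ι → ℝ × ℝ} (hI : ∀ i ∈ t, (I i).1 ∈ s ∧ (I i).2 ∈ s)
    (hd : t.PairwiseDisjoint fun i => uIoc (I i).1 (I i).2) :
    t.PairwiseDisjoint fun i => uIoc (W (I i).1) (W (I i).2) := by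
  have hmem : ∀ i ∈ t, ∀ x ∈ uIoc (W (I i).1) (W (I i).2),
      ∃ l ∈ s, ∃ u ∈ s, W l < x ∧ x ≤ W u ∧ Ioc l u = uIoc (I i).1 (I i).2 := by
    intro i hi x hx
    obtain ⟨h1, h2⟩ := hI i hi
    rcases le_total (I i).1 (I i).2 with h | h
    · rw [uIoc_of_le (hW h1 h2 h)] at hx
      exact ⟨_, h1, _, h2, hx.1, hx.2, (uIoc_of_le h).symm⟩
    · rw [uIoc_of_ge (hW h2 h1 h)] at hx
      exact ⟨_, h2, _, h1, hx.1, hx.2, (uIoc_of_ge h).symm⟩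
  intro i hi j hj hij
  refine Set.disjoint_left.2 fun x hxi hxj => ?_
  obtain ⟨l, hl, u, hu, h1, h2, h3⟩ := hmem i hi x hxi
  obtain ⟨l', hl', u', hu', h1', h2', h3'⟩ := hmem j hj x hxj
  have hd' := hd hi hj hij
  simp only [Function.onFun, ← h3, ← h3'] at hd'
  have e1 : l < u := lt_of_not_ge fun h => absurd (hW hu hl h) (by linarith)
  have e2 : l < u' := lt_of_not_ge fun h => absurd (hW hu' hl h) (by linarith)
  have e3 : l' < u := lt_of_not_ge fun h => absurd (hW hu hl' h) (by linarith)
  have e4 : l' < u' := lt_of_not_ge fun h => absurd (hW hu' hl' h) (by linarith)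
  have hmem₁ : min u u' ∈ Ioc l u := ⟨lt_min e1 e2, min_le_left _ _⟩
  exact Set.disjoint_left.1 hd' hmem₁ ⟨lt_min e3 e4, min_le_right _ _⟩

/-- The image intervals are disjoint and lie in `(W a, W b]`, so comparing Lebesgue measures bounds
their total length without ordering them. -/
lemma sum_dist_le_of_disjWithin {W : ℝ → ℝ} {a b : ℝ} (hab : a ≤ b)
    (hW : MonotoneOn W (Icc a b)) {D : ℕ × (ℕ → ℝ × ℝ)}
    (hD : D ∈ AbsolutelyContinuousOnInterval.disjWithin a b) :
    ∑ i ∈ Finset.range D.1, dist (W (D.2 i).1) (W (D.2 i).2) ≤ W b - W a := by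
  obtain ⟨h1, h2⟩ := hD
  rw [uIcc_of_le hab] at h1
  have hWab : W a ≤ W b := hW (left_mem_Icc.2 hab) (right_mem_Icc.2 hab) hab
  have hd := pairwiseDisjoint_uIoc_comp hW (t := ↑(Finset.range D.1)) (fun i hi => h1 i hi) h2
  have hv := measure_biUnion_finset (μ := volume) hd (fun i _ => measurableSet_uIoc)
  have hsub : (⋃ i ∈ Finset.range D.1, uIoc (W (D.2 i).1) (W (D.2 i).2)) ⊆ Ioc (W a) (W b) := by
    refine iUnion₂_subset fun i hi => ?_
    obtain ⟨⟨e1, e2⟩, e3, e4⟩ := h1 i hi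
    have m1 := hW (left_mem_Icc.2 hab) ⟨e1, e2⟩ e1
    have m2 := hW (left_mem_Icc.2 hab) ⟨e3, e4⟩ e3
    have m3 := hW ⟨e1, e2⟩ (right_mem_Icc.2 hab) e2
    have m4 := hW ⟨e3, e4⟩ (right_mem_Icc.2 hab) e4
    exact Ioc_subset_Ioc (le_min m1 m2) (max_le m3 m4)
  have hle := measure_mono (μ := volume) hsub
  rw [hv, Real.volume_Ioc] at hle
  have : ∀ i, volume (uIoc (W (D.2 i).1) (W (D.2 i).2)) =
      ENNReal.ofReal (dist (W (D.2 i).1) (W (D.2 i).2)) := by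
    intro i
    rw [Real.volume_uIoc, dist_comm, Real.dist_eq]
  simp only [this] at hle
  rw [← ENNReal.ofReal_sum_of_nonneg fun _ _ => dist_nonneg] at hle
  exact (ENNReal.ofReal_le_ofReal_iff (by linarith)).1 hle

/-- For `p > 1`, a function with a monotone Riesz control is absolutely continuous. -/
lemma absolutelyContinuousOnInterval_of_control {T p : ℝ} (hT : 0 ≤ T) (hp : 1 < p) {E : Type*}
    [MetricSpace E] {F : ℝ → E} {W : ℝ → ℝ} (hW : MonotoneOn W (Icc 0 T))
    (hF : ∀ a ∈ Icc 0 T, ∀ b ∈ Icc 0 T, a < b →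
        dist (F a) (F b) ^ p ≤ (W b - W a) * (b - a) ^ (p - 1)) :
    AbsolutelyContinuousOnInterval F 0 T := by
  set q := p / (p - 1) with hq
  have hpq : p.HolderConjugate q := Real.HolderConjugate.conjExponent hp
  have hp0 : 0 < p := by linarith
  have hq0 : 0 < q := hpq.symm.pos
  -- The `p`-th root of the control inequality, using `(p - 1) / p = 1 / q`; this is the form to
  -- which Hölder for sums applies.
  have key : ∀ a ∈ Icc 0 T, ∀ b ∈ Icc 0 T,
      dist (F a) (F b) ≤ dist (W a) (W b) ^ (1 / p) * dist a b ^ (1 / q) := by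
    have aux : ∀ a ∈ Icc 0 T, ∀ b ∈ Icc 0 T, a < b →
        dist (F a) (F b) ≤ dist (W a) (W b) ^ (1 / p) * dist a b ^ (1 / q) := by
      intro a ha b hb hab
      have h := hF a ha b hb hab
      have hWab := hW ha hb hab.le
      rw [dist_comm (W a), dist_comm a, Real.dist_eq, Real.dist_eq,
        abs_of_nonneg (by linarith), abs_of_nonneg (by linarith)]
      have h' := Real.rpow_le_rpow (Real.rpow_nonneg dist_nonneg _) h (one_div_nonneg.2 hp0.le)
      rw [← Real.rpow_mul dist_nonneg, mul_one_div_cancel hp0.ne', Real.rpow_one,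
        Real.mul_rpow (by linarith) (Real.rpow_nonneg (by linarith) _),
        ← Real.rpow_mul (by linarith)] at h'
      have e : (p - 1) * (1 / p) = 1 / q := by
        rw [hq]; field_simp
      rwa [e] at h'
    intro a ha b hb
    rcases lt_trichotomy a b with h | rfl | h
    · exact aux a ha b hb h
    · rw [dist_self]; positivity
    · have := aux b hb a ha h
      rwa [dist_comm (F a), dist_comm (W a), dist_comm a]
  have hlen : Tendsto (fun D : ℕ × (ℕ → ℝ × ℝ) =>
      (W T - W 0) ^ (1 / p) * (∑ i ∈ Finset.range D.1, dist (D.2 i).1 (D.2 i).2) ^ (1 / q))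
      (AbsolutelyContinuousOnInterval.totalLengthFilter ⊓
        𝓟 (AbsolutelyContinuousOnInterval.disjWithin 0 T)) (𝓝 0) := by
    have h0 : Tendsto (fun D : ℕ × (ℕ → ℝ × ℝ) =>
      ∑ i ∈ Finset.range D.1, dist (D.2 i).1 (D.2 i).2)
      (AbsolutelyContinuousOnInterval.totalLengthFilter ⊓
        𝓟 (AbsolutelyContinuousOnInterval.disjWithin 0 T)) (𝓝 0) :=
      tendsto_comap.mono_left inf_le_left
    have h1 := (h0.rpow_const (p := 1 / q) (Or.inr (by positivity))).const_mul
      ((W T - W 0) ^ (1 / p))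
    rwa [Real.zero_rpow (by positivity), mul_zero] at h1
  refine tendsto_of_tendsto_of_tendsto_of_le_of_le' tendsto_const_nhds hlen
    (Eventually.of_forall fun D => Finset.sum_nonneg fun _ _ => dist_nonneg) ?_
  filter_upwards [mem_inf_of_right (mem_principal_self _)] with D hD
  have hW' := sum_dist_le_of_disjWithin hT hW hD
  have hmem := hD.1
  rw [uIcc_of_le hT] at hmem
  calc ∑ i ∈ Finset.range D.1, dist (F (D.2 i).1) (F (D.2 i).2)
      ≤ ∑ i ∈ Finset.range D.1,
          dist (W (D.2 i).1) (W (D.2 i).2) ^ (1 / p) * dist (D.2 i).1 (D.2 i).2 ^ (1 / q) :=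
        Finset.sum_le_sum fun i hi => key _ (hmem i hi).1 _ (hmem i hi).2
    _ ≤ (∑ i ∈ Finset.range D.1, dist (W (D.2 i).1) (W (D.2 i).2)) ^ (1 / p) *
          (∑ i ∈ Finset.range D.1, dist (D.2 i).1 (D.2 i).2) ^ (1 / q) := by
        have h := Real.inner_le_Lp_mul_Lq_of_nonneg (Finset.range D.1) hpq
          (f := fun i => dist (W (D.2 i).1) (W (D.2 i).2) ^ (1 / p))
          (g := fun i => dist (D.2 i).1 (D.2 i).2 ^ (1 / q))
          (fun i _ => by positivity) (fun i _ => by positivity)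
        have e1 : ∀ x : ℝ, 0 ≤ x → (x ^ (1 / p)) ^ p = x := fun x hx => by
          rw [← Real.rpow_mul hx, one_div_mul_cancel hp0.ne', Real.rpow_one]
        have e2 : ∀ x : ℝ, 0 ≤ x → (x ^ (1 / q)) ^ q = x := fun x hx => by
          rw [← Real.rpow_mul hx, one_div_mul_cancel hq0.ne', Real.rpow_one]
        simpa only [e1 _ dist_nonneg, e2 _ dist_nonneg] using h
    _ ≤ _ := by
        gcongr

/-- The derivative of a function with a monotone Riesz control is bounded by the derivative of
the control. -/
lemma norm_rpow_le_of_hasDerivAt {T p : ℝ} (hp : 1 ≤ p) {E : Type*} [NormedAddCommGroup E]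
    [NormedSpace ℝ E] {F : ℝ → E} {W : ℝ → ℝ}
    (hF : ∀ a ∈ Icc 0 T, ∀ b ∈ Icc 0 T, a < b →
        dist (F a) (F b) ^ p ≤ (W b - W a) * (b - a) ^ (p - 1))
    {x w : ℝ} {v : E} (hx : x ∈ Ioo 0 T) (hv : HasDerivAt F v x) (hw : HasDerivAt W w x) :
    ‖v‖ ^ p ≤ w := by
  -- Right-hand slopes suffice, and match the ordering `a < b` in `hF`.
  have h1 := (hasDerivAt_iff_tendsto_slope.1 hv).mono_left
    (nhdsWithin_mono x (fun y (hy : x < y) => hy.ne') : 𝓝[>] x ≤ 𝓝[≠] x)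
  have h2 := (hasDerivAt_iff_tendsto_slope.1 hw).mono_left
    (nhdsWithin_mono x (fun y (hy : x < y) => hy.ne') : 𝓝[>] x ≤ 𝓝[≠] x)
  refine le_of_tendsto_of_tendsto (h1.norm.rpow_const (p := p) (Or.inr (by linarith))) h2 ?_
  filter_upwards [Ioo_mem_nhdsGT hx.2] with y hy
  have hxy : 0 < y - x := sub_pos.2 hy.1
  have h := hF x ⟨hx.1.le, hx.2.le⟩ y ⟨hx.1.le.trans hy.1.le, hy.2.le⟩ hy.1
  rw [slope_def_module, slope_def_field, norm_smul, norm_inv, Real.norm_of_nonneg hxy.le,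
    ← dist_eq_norm, dist_comm, Real.mul_rpow (by positivity) dist_nonneg,
    Real.inv_rpow hxy.le, inv_mul_le_iff₀ (by positivity)]
  calc _ ≤ _ := h
    _ = _ := by
      rw [Real.rpow_sub_one hxy.ne']
      field_simp

lemma _root_.LipschitzWith.comp_absolutelyContinuousOnInterval {X Y : Type*}
    [PseudoMetricSpace X] [PseudoMetricSpace Y] {K : ℝ≥0} {g : X → Y} (hg : LipschitzWith K g)
    {F : ℝ → X} {a b : ℝ} (hF : AbsolutelyContinuousOnInterval F a b) :
    AbsolutelyContinuousOnInterval (fun x => g (F x)) a b := by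
  have h := Tendsto.const_mul (K : ℝ) hF
  rw [mul_zero] at h
  refine squeeze_zero (fun D => Finset.sum_nonneg fun _ _ => dist_nonneg) (fun D => ?_) h
  rw [Finset.mul_sum]
  exact Finset.sum_le_sum fun i _ => hg.dist_le_mul _ _

/-! ### Fundamental theorem of calculus in Euclidean space, coordinatewise -/

section Euclidean

variable {d : ℕ} {F : ℝ → EuclideanSpace ℝ (Fin d)} {a b : ℝ}

lemma absolutelyContinuousOnInterval_apply (hF : AbsolutelyContinuousOnInterval F a b)
    (i : Fin d) : AbsolutelyContinuousOnInterval (fun x => F x i) a b :=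
  (EuclideanSpace.proj i : EuclideanSpace ℝ (Fin d) →L[ℝ] ℝ).lipschitz.comp_absolutelyContinuousOnInterval hF

lemma ae_differentiableAt_of_absolutelyContinuousOnInterval
    (hF : AbsolutelyContinuousOnInterval F a b) :
    ∀ᵐ x, x ∈ uIcc a b → DifferentiableAt ℝ F x := by
  have h := fun i => (absolutelyContinuousOnInterval_apply hF i).ae_differentiableAt
  filter_upwards [ae_all_iff.2 h] with x hx hmem
  exact differentiableAt_euclidean.2 fun i => hx i hmem

lemma integral_deriv_eq_sub_of_absolutelyContinuousOnInterval
    (hF : AbsolutelyContinuousOnInterval F a b)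
    (hint : IntervalIntegrable (deriv F) volume a b) :
    ∫ x in a..b, deriv F x = F b - F a := by
  ext i
  have h1 := (EuclideanSpace.proj i : EuclideanSpace ℝ (Fin d) →L[ℝ] ℝ).intervalIntegral_comp_comm hint
  have h2 := (absolutelyContinuousOnInterval_apply hF i).integral_deriv_eq_sub
  have h3 : ∫ x in a..b, deriv (fun y => F y i) x = ∫ x in a..b, deriv F x i := by
    refine intervalIntegral.integral_congr_ae ?_
    filter_upwards [ae_differentiableAt_of_absolutelyContinuousOnInterval hF] with x hx hmem
    exact ((EuclideanSpace.proj i : EuclideanSpace ℝ (Fin d) →L[ℝ] ℝ).hasFDerivAt.comp_hasDerivAt x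
      (hx (uIoc_subset_uIcc hmem)).hasDerivAt).deriv
  simp only [EuclideanSpace.coe_proj] at h1
  rw [PiLp.sub_apply, ← h2, h3, h1]

end Euclidean

/-- Integrate `‖F'‖^p ≤ W'`. The control may fail to be absolutely continuous, but a monotone
function always satisfies `∫ W' ≤ W T - W 0`, which is the direction needed. -/
lemma lintegral_norm_deriv_rpow_le {T p : ℝ} (hT : 0 ≤ T) (hp : 1 ≤ p) {E : Type*}
    [NormedAddCommGroup E] [NormedSpace ℝ E] {F : ℝ → E} {W : ℝ → ℝ}
    (hW : MonotoneOn W (Icc 0 T))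
    (hF : ∀ a ∈ Icc 0 T, ∀ b ∈ Icc 0 T, a < b →
        dist (F a) (F b) ^ p ≤ (W b - W a) * (b - a) ^ (p - 1))
    (hdiff : ∀ᵐ x, x ∈ Icc 0 T → DifferentiableAt ℝ F x) :
    ∫⁻ x in Icc 0 T, ‖deriv F x‖ₑ ^ p ≤ ENNReal.ofReal (W T - W 0) := by
  rw [← uIcc_of_le hT] at hW
  have hWint := hW.intervalIntegrable_deriv
  have hWle := hW.intervalIntegral_deriv_mem_uIcc
  rw [uIcc_of_le hT] at hW
  have hW0T := hW (left_mem_Icc.2 hT) (right_mem_Icc.2 hT) hT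
  rw [uIcc_of_le (by linarith)] at hWle
  have hpt : ∀ᵐ x, x ∈ Ioo 0 T → ‖deriv F x‖ ^ p ≤ deriv W x := by
    filter_upwards [hdiff, hW.ae_differentiableWithinAt_of_mem] with x h1 h2 hx
    exact norm_rpow_le_of_hasDerivAt hp hF hx (h1 ⟨hx.1.le, hx.2.le⟩).hasDerivAt
      (((h2 ⟨hx.1.le, hx.2.le⟩).differentiableAt (Icc_mem_nhds hx.1 hx.2)).hasDerivAt)
  have hint : Integrable (deriv W) (volume.restrict (Ioo 0 T)) :=
    (hWint.1).mono_set Ioo_subset_Ioc_self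
  have hpt' := (ae_restrict_iff' (measurableSet_Ioo (a := (0 : ℝ)) (b := T))).2 hpt
  calc ∫⁻ x in Icc 0 T, ‖deriv F x‖ₑ ^ p = ∫⁻ x in Ioo 0 T, ‖deriv F x‖ₑ ^ p := by
        rw [restrict_Ioo_eq_restrict_Icc]
    _ ≤ ∫⁻ x in Ioo 0 T, ENNReal.ofReal (deriv W x) := by
        refine lintegral_mono_ae (hpt'.mono fun x hx => ?_)
        rw [← ofReal_norm, ENNReal.ofReal_rpow_of_nonneg (norm_nonneg _) (by linarith)]
        exact ENNReal.ofReal_le_ofReal hx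
    _ = ENNReal.ofReal (∫ x in Ioo 0 T, deriv W x) :=
        (ofReal_integral_eq_lintegral_ofReal hint
          (hpt'.mono fun x hx => (Real.rpow_nonneg (norm_nonneg _) _).trans hx)).symm
    _ ≤ _ := by
        rw [← integral_Ioc_eq_integral_Ioo, ← intervalIntegral.integral_of_le hT]
        exact ENNReal.ofReal_le_ofReal hWle.2

/-! ### Transfer between the subtype `[0,T]` and the real line -/

section Interval

variable {T : ℝ}

lemma measurePreserving_val :
    MeasurePreserving (Subtype.val : Icc (0 : ℝ) T → ℝ) (leb T) (volume.restrict (Icc 0 T)) :=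
  measurePreserving_subtype_coe measurableSet_Icc

instance isFiniteMeasure_leb : IsFiniteMeasure (leb T) := by
  constructor
  have h := measurePreserving_val.measure_preimage (μa := leb T) MeasurableSet.univ.nullMeasurableSet
  rw [preimage_univ] at h
  rw [h]
  simp

lemma ae_leb_Ioo : ∀ᵐ s : Icc (0 : ℝ) T ∂(leb T), (s : ℝ) ∈ Ioo 0 T := by
  refine measurePreserving_val.quasiMeasurePreserving.ae ?_
  rw [← restrict_Ioo_eq_restrict_Icc]
  exact ae_restrict_mem measurableSet_Ioo

lemma ae_leb_of_ae {P : ℝ → Prop} (h : ∀ᵐ x, P x) : ∀ᵐ s : Icc (0 : ℝ) T ∂(leb T), P s :=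
  measurePreserving_val.quasiMeasurePreserving.ae (ae_restrict_of_ae h)

variable {E : Type*} [NormedAddCommGroup E] [NormedSpace ℝ E]

lemma measurableEmbedding_val : MeasurableEmbedding (Subtype.val : Icc (0 : ℝ) T → ℝ) :=
  .subtype_coe measurableSet_Icc

lemma primitive_coe (φ : ℝ → E) (t : Icc (0 : ℝ) T) :
    primitive (fun s : Icc (0 : ℝ) T => φ s) t = ∫ s in (0 : ℝ)..t, φ s := by
  rw [primitive, intervalIntegral.integral_of_le t.2.1, ← integral_Icc_eq_integral_Ioc]
  have h := measurePreserving_val.setIntegral_preimage_emb (μ := leb T) measurableEmbedding_val φ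
    (Iic (t : ℝ))
  rw [Measure.restrict_restrict measurableSet_Iic] at h
  have e : Iic (t : ℝ) ∩ Icc 0 T = Icc 0 (t : ℝ) := by
    ext x
    have := t.2.2
    simp only [mem_inter_iff, mem_Iic, mem_Icc]
    constructor <;> intro h <;> refine ⟨?_, ?_⟩ <;> grind
  rw [e] at h
  exact h

lemma primitive_eq_intervalIntegral (hT : 0 ≤ T) (φ : Icc (0 : ℝ) T → E) (t : Icc (0 : ℝ) T) :
    primitive φ t = ∫ s in (0 : ℝ)..t, IccExtend hT φ s := by
  rw [← primitive_coe]
  simp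

omit [NormedSpace ℝ E] in
lemma intervalIntegrable_IccExtend (hT : 0 ≤ T) {φ : Icc (0 : ℝ) T → E}
    (hφ : Integrable φ (leb T)) : IntervalIntegrable (IccExtend hT φ) volume 0 T := by
  rw [intervalIntegrable_iff_integrableOn_Icc_of_le hT, IntegrableOn,
    ← measurePreserving_val.integrable_comp_emb measurableEmbedding_val]
  convert! hφ using 1
  ext s
  simp

lemma derivative_eq_deriv (hT : 0 ≤ T) (f : Icc (0 : ℝ) T → E) {s : Icc (0 : ℝ) T}
    (hs : (s : ℝ) ∈ Ioo 0 T) : derivative hT f s = deriv (IccExtend hT f) s :=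
  derivWithin_of_mem_nhds (Icc_mem_nhds hs.1 hs.2)

/-- Lebesgue's differentiation theorem on `[0,T]`. -/
lemma derivative_const_add_primitive [CompleteSpace E] (hT : 0 ≤ T) {φ : Icc (0 : ℝ) T → E}
    (hφ : Integrable φ (leb T)) (x₀ : E) :
    derivative hT (fun t => x₀ + primitive φ t) =ᵐ[leb T] φ := by
  have h := ae_leb_of_ae (T := T) (intervalIntegrable_IccExtend hT hφ).ae_hasDerivAt_integral
  filter_upwards [h, ae_leb_Ioo] with s hs hmem
  have h1 := hs (by rw [uIcc_of_le hT]; exact s.2) 0 (by simp)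
  rw [IccExtend_val] at h1
  rw [derivative_eq_deriv hT _ hmem]
  refine HasDerivAt.deriv ((h1.const_add x₀).congr_of_eventuallyEq ?_)
  filter_upwards [Icc_mem_nhds hmem.1 hmem.2] with x hx
  rw [IccExtend_of_mem _ _ hx, primitive_eq_intervalIntegral hT]

end Interval

/-! ### Riesz's theorem for the derivative -/

section Derivative

variable {T p : ℝ} {d : ℕ} {f : Icc (0 : ℝ) T → EuclideanSpace ℝ (Fin d)}

lemma derivative_ae_eq_deriv (hT : 0 ≤ T) :
    derivative hT f =ᵐ[leb T] fun s => deriv (IccExtend hT f) s :=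
  ae_leb_Ioo.mono fun _ hs => derivative_eq_deriv hT f hs

lemma aestronglyMeasurable_derivative (hT : 0 ≤ T) :
    AEStronglyMeasurable (derivative hT f) (leb T) :=
  ((stronglyMeasurable_deriv (IccExtend hT f)).comp_measurable
    measurable_subtype_coe).aestronglyMeasurable.congr (derivative_ae_eq_deriv hT).symm

lemma absolutelyContinuous_of_variation_lt_top (hT : 0 ≤ T) (hp : 1 < p)
    (hf : variation p f < ∞) : IsAbsolutelyContinuous hT f := by
  obtain ⟨W, hW, -, hF⟩ := exists_monotoneOn_control hT hf
  exact absolutelyContinuousOnInterval_of_control hT hp hW hF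

/-- F. Riesz: the `p`-th power of the derivative has integral at most the variation. -/
lemma lintegral_derivative_rpow_le (hT : 0 ≤ T) (hp : 1 ≤ p) (hf : variation p f < ∞)
    (hac : IsAbsolutelyContinuous hT f) :
    ∫⁻ s, ‖derivative hT f s‖ₑ ^ p ∂(leb T) ≤ variation p f := by
  obtain ⟨W, hW, hWle, hF⟩ := exists_monotoneOn_control hT hf
  have hdiff := ae_differentiableAt_of_absolutelyContinuousOnInterval hac
  rw [uIcc_of_le hT] at hdiff
  refine le_trans (le_of_eq ?_) ((lintegral_norm_deriv_rpow_le hT hp hW hF hdiff).trans hWle)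
  rw [← measurePreserving_val.lintegral_comp_emb (μ := leb T) measurableEmbedding_val]
  exact lintegral_congr_ae ((derivative_ae_eq_deriv (f := f) hT).mono fun s hs => by simp only [hs])

lemma memLp_ofReal_of_lintegral_rpow_lt_top {X E : Type*} [MeasurableSpace X] {μ : Measure X}
    [NormedAddCommGroup E] {φ : X → E} (hp : 1 ≤ p) (hφ : AEStronglyMeasurable φ μ)
    (h : ∫⁻ s, ‖φ s‖ₑ ^ p ∂μ < ∞) : MemLp φ (ENNReal.ofReal p) μ := by
  refine ⟨hφ, ?_⟩
  rw [eLpNorm_lt_top_iff_lintegral_rpow_enorm_lt_top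
    (ENNReal.ofReal_pos.2 (by linarith)).ne' ENNReal.ofReal_ne_top,
    ENNReal.toReal_ofReal (by linarith)]
  exact h

lemma memLp_derivative (hT : 0 ≤ T) (hp : 1 ≤ p) (hf : variation p f < ∞)
    (hac : IsAbsolutelyContinuous hT f) :
    MemLp (derivative hT f) (ENNReal.ofReal p) (leb T) :=
  memLp_ofReal_of_lintegral_rpow_lt_top hp (aestronglyMeasurable_derivative hT)
    ((lintegral_derivative_rpow_le hT hp hf hac).trans_lt hf)

lemma primitive_congr {E : Type*} [NormedAddCommGroup E] [NormedSpace ℝ E]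
    {φ ψ : Icc (0 : ℝ) T → E} (h : φ =ᵐ[leb T] ψ) : primitive φ = primitive ψ :=
  funext fun _ => integral_congr_ae (ae_restrict_of_ae h)

lemma eq_add_primitive_derivative (hT : 0 ≤ T) (hac : IsAbsolutelyContinuous hT f)
    (hint : Integrable (derivative hT f) (leb T)) (t : Icc (0 : ℝ) T) :
    f t = f ⟨0, left_mem_Icc.2 hT⟩ + primitive (derivative hT f) t := by
  have hint' : IntegrableOn (deriv (IccExtend hT f)) (Icc 0 T) := by
    rw [IntegrableOn, ← measurePreserving_val.integrable_comp_emb measurableEmbedding_val]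
    exact hint.congr (derivative_ae_eq_deriv hT)
  have hsub : uIcc 0 (t : ℝ) ⊆ uIcc 0 T := by
    rw [uIcc_of_le t.2.1, uIcc_of_le hT]
    exact Icc_subset_Icc_right t.2.2
  have h := integral_deriv_eq_sub_of_absolutelyContinuousOnInterval (hac.mono hsub)
    ((intervalIntegrable_iff_integrableOn_Icc_of_le t.2.1).2
      (hint'.mono_set (Icc_subset_Icc_right t.2.2)))
  rw [primitive_congr (derivative_ae_eq_deriv hT), primitive_coe, h, IccExtend_val,
    IccExtend_of_mem hT f (left_mem_Icc.2 hT)]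
  abel

end Derivative

/-! ### Variation and sup norm of primitives -/

section Primitive

variable {T p : ℝ} {E : Type*} [NormedAddCommGroup E] [NormedSpace ℝ E]

lemma leb_Ioc (a b : Icc (0 : ℝ) T) : leb T (Ioc a b) = ENNReal.ofReal (b - a) := by
  rw [measurableEmbedding_val.comap_apply, ← Real.volume_Ioc]
  congr 1
  ext x
  simp only [mem_image, mem_Ioc, Subtype.exists, ← Subtype.coe_lt_coe, ← Subtype.coe_le_coe]
  constructor
  · rintro ⟨y, hy, h, rfl⟩; exact h
  · intro h
    exact ⟨x, ⟨a.2.1.trans h.1.le, h.2.trans b.2.2⟩, h, rfl⟩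

lemma enorm_primitive_sub_le {φ : Icc (0 : ℝ) T → E} (hφ : Integrable φ (leb T))
    {a b : Icc (0 : ℝ) T} (hab : a ≤ b) :
    ‖primitive φ b - primitive φ a‖ₑ ≤ ∫⁻ s in Ioc a b, ‖φ s‖ₑ ∂(leb T) := by
  rw [primitive, primitive, ← setIntegral_sdiff measurableSet_Iic hφ.integrableOn
    (Iic_subset_Iic.2 hab), Iic_sdiff_Iic]
  exact enorm_integral_le_lintegral_enorm _

/-- Hölder on `(a,b]`: the factor `(b - a)^(p - 1)` it produces is exactly the denominator of the
Riesz term. -/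
lemma ofReal_riesz_term_le (hp : 1 ≤ p) {φ : Icc (0 : ℝ) T → E}
    (hφ : MemLp φ (ENNReal.ofReal p) (leb T)) (x₀ : E) {a b : Icc (0 : ℝ) T} (hab : a < b) :
    ENNReal.ofReal (dist (x₀ + primitive φ a) (x₀ + primitive φ b) ^ p /
      ((b : ℝ) - a) ^ (p - 1)) ≤ ∫⁻ s in Ioc a b, ‖φ s‖ₑ ^ p ∂(leb T) := by
  have hp0 : 0 < p := by linarith
  have hp1 : 1 ≤ ENNReal.ofReal p := by simpa using ENNReal.ofReal_le_ofReal hp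
  have hba : 0 < (b : ℝ) - a := sub_pos.2 hab
  have h1 := enorm_primitive_sub_le (hφ.integrable hp1) hab.le
  have h2 := eLpNorm_le_eLpNorm_mul_rpow_measure_univ (μ := (leb T).restrict (Ioc a b)) hp1
    hφ.1.restrict
  rw [eLpNorm_one_eq_lintegral_enorm, eLpNorm_eq_lintegral_rpow_enorm_toReal
    (ENNReal.ofReal_pos.2 hp0).ne' ENNReal.ofReal_ne_top, ENNReal.toReal_ofReal hp0.le,
    Measure.restrict_apply_univ, leb_Ioc, ENNReal.toReal_one, div_one] at h2
  have h3 := ENNReal.rpow_le_rpow (h1.trans h2) hp0.le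
  rw [ENNReal.mul_rpow_of_nonneg _ _ hp0.le, ← ENNReal.rpow_mul, ← ENNReal.rpow_mul,
    one_div_mul_cancel hp0.ne', ENNReal.rpow_one, sub_mul, one_div_mul_cancel hp0.ne', one_mul,
    ENNReal.ofReal_rpow_of_pos hba] at h3
  rw [ENNReal.ofReal_div_of_pos (by positivity)]
  refine ENNReal.div_le_of_le_mul (le_trans (le_of_eq ?_) h3)
  rw [dist_add_left, dist_comm, dist_eq_norm, ← ofReal_norm,
    ENNReal.ofReal_rpow_of_nonneg (norm_nonneg _) hp0.le]

lemma variation_const_add_primitive_le (hp : 1 ≤ p) {φ : Icc (0 : ℝ) T → E}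
    (hφ : MemLp φ (ENNReal.ofReal p) (leb T)) (x₀ : E) :
    variation p (fun t => x₀ + primitive φ t) ≤ ∫⁻ s, ‖φ s‖ₑ ^ p ∂(leb T) := by
  refine iSup_le fun n => iSup_le fun u => iSup_le fun ⟨hu, _, _⟩ => ?_
  calc _ ≤ ∑ i : Fin n, ∫⁻ s in Ioc (u i.castSucc) (u i.succ), ‖φ s‖ₑ ^ p ∂(leb T) :=
        Finset.sum_le_sum fun i _ => ofReal_riesz_term_le hp hφ x₀ (hu Fin.castSucc_lt_succ)
    _ = ∫⁻ s in ⋃ i ∈ (Finset.univ : Finset (Fin n)), Ioc (u i.castSucc) (u i.succ),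
          ‖φ s‖ₑ ^ p ∂(leb T) := by
        refine (lintegral_biUnion_finset ?_ (fun _ _ => measurableSet_Ioc) _).symm
        have hlt : ∀ i j : Fin n, i < j →
            Disjoint (Ioc (u i.castSucc) (u i.succ)) (Ioc (u j.castSucc) (u j.succ)) := by
          intro i j hij
          refine Set.disjoint_left.2 fun x hx hx' => ?_
          have : u i.succ ≤ u j.castSucc := hu.monotone (by
            rw [Fin.le_def]; simpa using Nat.succ_le_of_lt hij)
          exact absurd (hx.2.trans this) (not_le.2 hx'.1)
        intro i _ j _ hij
        rcases lt_or_gt_of_ne hij with h | h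
        · exact hlt i j h
        · exact (hlt j i h).symm
    _ ≤ _ := setLIntegral_le_lintegral _ _

lemma const_add_primitive_mem_BV (hp : 1 ≤ p) {φ : Icc (0 : ℝ) T → E}
    (hφ : MemLp φ (ENNReal.ofReal p) (leb T)) (x₀ : E) :
    (fun t => x₀ + primitive φ t) ∈ BV T p E := by
  refine (variation_const_add_primitive_le hp hφ x₀).trans_lt ?_
  have h := (eLpNorm_lt_top_iff_lintegral_rpow_enorm_lt_top
    (ENNReal.ofReal_pos.2 (by linarith)).ne' ENNReal.ofReal_ne_top).1 hφ.2
  rwa [ENNReal.toReal_ofReal (by linarith)] at h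

lemma supNorm_primitive_sub_le {φ ψ : Icc (0 : ℝ) T → E} (hφ : Integrable φ (leb T))
    (hψ : Integrable ψ (leb T)) (x₀ : E) :
    supNorm ((fun t => x₀ + primitive φ t) - fun t => x₀ + primitive ψ t) ≤
      ∫⁻ s, ‖φ s - ψ s‖ₑ ∂(leb T) := by
  refine iSup_le fun t => ?_
  rw [Pi.sub_apply, add_sub_add_left_eq_sub, primitive, primitive,
    ← integral_sub hφ.integrableOn hψ.integrableOn]
  exact (enorm_integral_le_lintegral_enorm _).trans (setLIntegral_le_lintegral _ _)

end Primitive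

/-! ### Decomposable and closed sets of functions -/

open scoped Classical in
/-- A set of functions is decomposable along `A` if it contains `1_A φ + 1_{Aᶜ} ψ` for any two of
its elements `φ`, `ψ`. -/
def DecomposableAlong {X E : Type*} (D : Set (X → E)) (A : Set X) : Prop :=
  ∀ φ ∈ D, ∀ ψ ∈ D, A.piecewise φ ψ ∈ D

section DecomposableAlong

variable {X E : Type*} {D : Set (X → E)} {A B : Set X}

lemma DecomposableAlong.compl (hA : DecomposableAlong D A) : DecomposableAlong D Aᶜ := by
  classical
  intro φ hφ ψ hψ
  convert! hA ψ hψ φ hφ using 1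
  ext x
  by_cases hx : x ∈ A <;> simp [hx]

lemma DecomposableAlong.union (hA : DecomposableAlong D A) (hB : DecomposableAlong D B) :
    DecomposableAlong D (A ∪ B) := by
  classical
  intro φ hφ ψ hψ
  convert! hA φ hφ _ (hB φ hφ ψ hψ) using 1
  ext x
  by_cases hx : x ∈ A <;> by_cases hx' : x ∈ B <;> simp [hx, hx']

lemma decomposableAlong_empty : DecomposableAlong D ∅ := by
  intro φ hφ ψ hψ
  simpa using hψ

end DecomposableAlong

variable {X E : Type*} [MeasurableSpace X] {μ : Measure X} [NormedAddCommGroup E]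
  {D : Set (X → E)}

/-- `D` is a set of integrable functions closed under approximation in `L¹` by its elements. -/
structure IsL1Closed (μ : Measure X) (p : ℝ≥0∞) (D : Set (X → E)) : Prop where
  memLp : ∀ φ ∈ D, MemLp φ p μ
  mem_of_approx : ∀ φ, MemLp φ p μ → (∀ ε : ℝ≥0∞, 0 < ε → ∃ ψ ∈ D, ∫⁻ x, ‖φ x - ψ x‖ₑ ∂μ < ε) →
    φ ∈ D

/-- Dominated convergence: the form in which closedness is used below, the bound `b` being on the
differences. -/
lemma IsL1Closed.mem_of_tendsto {p : ℝ≥0∞} (hD : IsL1Closed μ p D) {φ : X → E}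
    (hφ : MemLp φ p μ) {χ : ℕ → X → E} (hχ : ∀ n, χ n ∈ D) {b : X → ℝ≥0∞}
    (hb : ∫⁻ x, b x ∂μ ≠ ∞) (hle : ∀ n, ∀ᵐ x ∂μ, ‖φ x - χ n x‖ₑ ≤ b x)
    (hlim : ∀ᵐ x ∂μ, Tendsto (fun n => χ n x) atTop (𝓝 (φ x))) : φ ∈ D := by
  refine hD.mem_of_approx φ hφ fun ε hε => ?_
  have h := tendsto_lintegral_of_dominated_convergence' (μ := μ)
    (F := fun n x => ‖φ x - χ n x‖ₑ) (f := fun _ => 0) b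
    (fun n => (hφ.1.sub (hD.memLp _ (hχ n)).1).enorm) hle hb ?_
  · rw [lintegral_zero] at h
    obtain ⟨n, hn⟩ := (h.eventually_lt_const hε).exists
    exact ⟨χ n, hχ n, hn⟩
  · filter_upwards [hlim] with x hx
    have := (tendsto_const_nhds (x := φ x)).sub hx
    rw [sub_self] at this
    simpa using this.enorm

lemma IsL1Closed.congr {p : ℝ≥0∞} (hD : IsL1Closed μ p D) {φ ψ : X → E} (hφ : φ ∈ D)
    (h : φ =ᵐ[μ] ψ) : ψ ∈ D := by
  refine hD.mem_of_tendsto ((memLp_congr_ae h).1 (hD.memLp φ hφ)) (χ := fun _ => φ)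
    (fun _ => hφ) (b := fun _ => 0) (by simp) (fun _ => ?_) ?_
  · filter_upwards [h] with x hx
    simp [hx]
  · filter_upwards [h] with x hx
    rw [hx]
    exact tendsto_const_nhds

lemma lintegral_enorm_sub_ne_top [IsFiniteMeasure μ] {p : ℝ≥0∞} (hp : 1 ≤ p) {φ ψ : X → E}
    (hφ : MemLp φ p μ) (hψ : MemLp ψ p μ) : ∫⁻ x, ‖φ x - ψ x‖ₑ ∂μ ≠ ∞ :=
  ((hφ.integrable hp).sub (hψ.integrable hp)).2.ne

/-- The mixtures along the finite unions `accumulate A n` lie in `D`, are eventually constant at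
each point, and differ from the limit by at most `‖φ - ψ‖`. -/
lemma IsL1Closed.decomposableAlong_iUnion [IsFiniteMeasure μ] {p : ℝ≥0∞} (hp : 1 ≤ p)
    (hD : IsL1Closed μ p D) {A : ℕ → Set X} (hAm : ∀ n, MeasurableSet (A n))
    (hA : ∀ n, DecomposableAlong D (A n)) : DecomposableAlong D (⋃ n, A n) := by
  classical
  intro φ hφ ψ hψ
  have hacc : ∀ n, DecomposableAlong D (accumulate A n) := by
    intro n
    induction n with
    | zero => rw [accumulate_zero_nat]; exact hA 0
    | succ n ih => rw [accumulate_succ]; exact ih.union (hA _)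
  have hφ' := hD.memLp φ hφ
  have hψ' := hD.memLp ψ hψ
  refine hD.mem_of_tendsto (χ := fun n => (accumulate A n).piecewise φ ψ)
    (hφ'.restrict _ |>.piecewise (MeasurableSet.iUnion hAm) (hψ'.restrict _)) (fun n => hacc n φ hφ ψ hψ)
    (b := fun x => ‖φ x - ψ x‖ₑ) (lintegral_enorm_sub_ne_top hp hφ' hψ') (fun n => ?_) ?_
  · refine Eventually.of_forall fun x => ?_
    by_cases h1 : x ∈ accumulate A n
    · have h2 : x ∈ ⋃ n, A n := by
        rw [mem_accumulate] at h1
        obtain ⟨i, -, hi⟩ := h1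
        exact mem_iUnion_of_mem i hi
      simp only [piecewise_eq_of_mem _ _ _ h1, piecewise_eq_of_mem _ _ _ h2]
      simp
    · by_cases h2 : x ∈ ⋃ n, A n
      · simp only [piecewise_eq_of_notMem _ _ _ h1, piecewise_eq_of_mem _ _ _ h2]
        exact le_rfl
      · simp only [piecewise_eq_of_notMem _ _ _ h1, piecewise_eq_of_notMem _ _ _ h2]
        simp
  · refine Eventually.of_forall fun x => tendsto_const_nhds.congr' ?_
    by_cases h2 : x ∈ ⋃ n, A n
    · obtain ⟨i, hi⟩ := mem_iUnion.1 h2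
      filter_upwards [eventually_ge_atTop i] with n hn
      rw [piecewise_eq_of_mem _ _ _ h2, piecewise_eq_of_mem _ _ _ (mem_accumulate.2 ⟨i, hn, hi⟩)]
    · refine Eventually.of_forall fun n => ?_
      have h1 : x ∉ accumulate A n := fun h => by
        obtain ⟨i, -, hi⟩ := mem_accumulate.1 h
        exact h2 (mem_iUnion_of_mem i hi)
      simp only [piecewise_eq_of_notMem _ _ _ h2, piecewise_eq_of_notMem _ _ _ h1]

/-- Decomposability along initial intervals and closedness imply decomposability along Borel
sets. -/
lemma IsL1Closed.decomposableAlong_of_Iio {X : Type*} [MeasurableSpace X] [TopologicalSpace X]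
    [BorelSpace X] [LinearOrder X] [OrderTopology X] [SecondCountableTopology X] {μ : Measure X}
    [IsFiniteMeasure μ] {D : Set (X → E)} {p : ℝ≥0∞} (hp : 1 ≤ p) (hD : IsL1Closed μ p D)
    (h : ∀ a, DecomposableAlong D (Iio a)) {A : Set X} (hA : MeasurableSet A) :
    DecomposableAlong D A := by
  have hgen : ‹MeasurableSpace X› = MeasurableSpace.generateFrom (range (Iio : X → Set X)) := by
    rw [← borel_eq_generateFrom_Iio]
    exact BorelSpace.measurable_eq
  induction A, hA using MeasurableSpace.induction_on_inter hgen isPiSystem_Iio with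
  | empty => exact decomposableAlong_empty
  | basic t ht => obtain ⟨a, rfl⟩ := ht; exact h a
  | compl t _ ih => exact ih.compl
  | iUnion f _ hm ih => exact hD.decomposableAlong_iUnion hp hm ih

/-! ### Greedy selections and the Hiai-Umegaki theorem -/

/-- Greedy selection: among finitely many elements of a decomposable set one can choose pointwise
a minimizer of a measurable cost function. -/
lemma exists_greedy_selection [MeasurableSpace E] [BorelSpace E] {β : Type*} [LinearOrder β]
    [TopologicalSpace β] [OrderClosedTopology β] [SecondCountableTopology β] [MeasurableSpace β]
    [OpensMeasurableSpace β]
    (hdec : ∀ A, MeasurableSet A → DecomposableAlong D A) {φ : ℕ → X → E} (hφ : ∀ n, φ n ∈ D)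
    (hφm : ∀ n, Measurable (φ n)) {c : X → E → β} (hc : ∀ ψ : X → E, Measurable ψ →
      Measurable fun x => c x (ψ x)) :
    ∃ χ : ℕ → X → E, (∀ n, χ n ∈ D) ∧ (∀ n, Measurable (χ n)) ∧
      (∀ n x, ∀ k ≤ n, c x (χ n x) ≤ c x (φ k x)) ∧ ∀ n x, ∃ k ≤ n, χ n x = φ k x := by
  classical
  -- Switch to `φ (n + 1)` exactly where it is strictly cheaper than the current choice; each switch
  -- is one mixture along a measurable set.
  let χ : ℕ → X → E := fun n => Nat.rec (φ 0)
    (fun n ψ => {x | c x (φ (n + 1) x) < c x (ψ x)}.piecewise (φ (n + 1)) ψ) n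
  have hsucc : ∀ n, χ (n + 1) =
      {x | c x (φ (n + 1) x) < c x (χ n x)}.piecewise (φ (n + 1)) (χ n) := fun n => rfl
  have hpos : ∀ n x, c x (φ (n + 1) x) < c x (χ n x) → χ (n + 1) x = φ (n + 1) x :=
    fun n x hx => if_pos hx
  have hneg : ∀ n x, ¬ c x (φ (n + 1) x) < c x (χ n x) → χ (n + 1) x = χ n x :=
    fun n x hx => if_neg hx
  have hm : ∀ n, Measurable (χ n) := by
    intro n
    induction n with
    | zero => exact hφm 0
    | succ n ih =>
      rw [hsucc]
      exact (hφm _).piecewise (measurableSet_lt (hc _ (hφm _)) (hc _ ih)) ih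
  refine ⟨χ, fun n => ?_, hm, fun n => ?_, fun n => ?_⟩
  · induction n with
    | zero => exact hφ 0
    | succ n ih =>
      rw [hsucc]
      convert! hdec _ (measurableSet_lt (hc _ (hφm (n + 1))) (hc _ (hm n))) _ (hφ _) _ ih
  · induction n with
    | zero =>
      intro x k hk
      obtain rfl : k = 0 := by omega
      exact le_rfl
    | succ n ih =>
      intro x k hk
      by_cases hx : c x (φ (n + 1) x) < c x (χ n x)
      · rw [hpos n x hx]
        rcases hk.eq_or_lt with rfl | hk
        · exact le_rfl
        · exact hx.le.trans (ih x k (by omega))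
      · rw [hneg n x hx]
        rcases hk.eq_or_lt with rfl | hk
        · exact not_lt.1 hx
        · exact ih x k (by omega)
  · induction n with
    | zero => exact fun x => ⟨0, le_rfl, rfl⟩
    | succ n ih =>
      intro x
      by_cases hx : c x (φ (n + 1) x) < c x (χ n x)
      · exact ⟨n + 1, le_rfl, hpos n x hx⟩
      · obtain ⟨k, hk, h⟩ := ih x
        exact ⟨k, by omega, (hneg n x hx).trans h⟩

/-- A decomposable, `L¹`-closed set contains every `L^p` function that is pointwise in the closure
of a sequence of its elements. -/
lemma IsL1Closed.mem_of_ae_mem_closure [IsFiniteMeasure μ] [MeasurableSpace E] [BorelSpace E]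
    [SecondCountableTopology E] {p : ℝ≥0∞}
    (hp : 1 ≤ p) (hD : IsL1Closed μ p D) (hdec : ∀ A, MeasurableSet A → DecomposableAlong D A)
    {φ : ℕ → X → E} (hφ : ∀ n, φ n ∈ D) (hφm : ∀ n, Measurable (φ n)) {ψ : X → E}
    (hψ : MemLp ψ p μ) (h : ∀ᵐ x ∂μ, ψ x ∈ closure (range fun n => φ n x)) : ψ ∈ D := by
  obtain ⟨ψ', hψ'm, hψ'⟩ := hψ.1
  obtain ⟨χ, hχ, -, hmin, -⟩ := exists_greedy_selection hdec hφ hφm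
    (c := fun x y => ‖ψ' x - y‖ₑ) (fun u hu => (hψ'm.measurable.sub hu).enorm)
  -- `χ n` is the nearest of `φ 0, …, φ n` to `ψ`, so the error never exceeds that of `φ 0`.
  refine hD.mem_of_tendsto hψ hχ (b := fun x => ‖ψ x - φ 0 x‖ₑ)
    (lintegral_enorm_sub_ne_top hp hψ (hD.memLp _ (hφ 0))) (fun n => ?_) ?_
  · filter_upwards [hψ'] with x hx
    rw [hx]
    exact hmin n x 0 (Nat.zero_le n)
  · filter_upwards [hψ', h] with x hx hcl
    rw [EMetric.tendsto_atTop]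
    intro ε hε
    obtain ⟨_, ⟨k, rfl⟩, hk⟩ := EMetric.mem_closure_iff.1 hcl ε hε
    refine ⟨k, fun n hn => lt_of_le_of_lt ?_ hk⟩
    rw [edist_comm, edist_eq_enorm_sub, edist_eq_enorm_sub, hx]
    exact hmin n x k hn

/-- A bounded decomposable subset of `L^p` is dominated along sequences. -/
lemma lintegral_iSup_enorm_rpow_le [MeasurableSpace E] [BorelSpace E] {p : ℝ} (hp : 0 < p)
    (hdec : ∀ A, MeasurableSet A → DecomposableAlong D A)
    {φ : ℕ → X → E} (hφ : ∀ n, φ n ∈ D) (hφm : ∀ n, Measurable (φ n)) {C : ℝ≥0∞}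
    (hC : ∀ ψ ∈ D, ∫⁻ x, ‖ψ x‖ₑ ^ p ∂μ ≤ C) : ∫⁻ x, (⨆ n, ‖φ n x‖ₑ) ^ p ∂μ ≤ C := by
  -- Reversing the order turns the minimizer into a choice of largest norm.
  obtain ⟨χ, hχ, hχm, hmax, hmem⟩ := exists_greedy_selection hdec hφ hφm
    (c := fun _ y => OrderDual.toDual ‖y‖ₑ) (fun u hu => hu.enorm)
  have hmono : Monotone fun n x => ‖χ n x‖ₑ ^ p := by
    intro m n hmn x
    obtain ⟨k, hk, h⟩ := hmem m x
    simp only [h]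
    exact ENNReal.rpow_le_rpow (hmax n x k (hk.trans hmn)) hp.le
  calc ∫⁻ x, (⨆ n, ‖φ n x‖ₑ) ^ p ∂μ ≤ ∫⁻ x, ⨆ n, ‖χ n x‖ₑ ^ p ∂μ := by
        refine lintegral_mono fun x => ?_
        rw [← ENNReal.le_rpow_inv_iff hp]
        refine iSup_le fun n => ?_
        rw [ENNReal.le_rpow_inv_iff hp]
        exact (ENNReal.rpow_le_rpow (hmax n x n le_rfl) hp.le).trans
          (le_iSup (fun n => ‖χ n x‖ₑ ^ p) n)
    _ = ⨆ n, ∫⁻ x, ‖χ n x‖ₑ ^ p ∂μ :=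
        lintegral_iSup (fun n => (hχm n).enorm.pow_const p) hmono
    _ ≤ C := iSup_le fun n => hC _ (hχ n)

/-- A set of integrable functions contains a sequence whose pointwise closure contains almost
everywhere the values of each of its elements. -/
lemma IsL1Closed.exists_seq_ae_mem_closure [IsFiniteMeasure μ] [MeasurableSpace.CountablyGenerated X]
    [MeasurableSpace E] [BorelSpace E] [SecondCountableTopology E] {p : ℝ≥0∞} (hp : 1 ≤ p)
    (hD : IsL1Closed μ p D) (hne : D.Nonempty) :
    ∃ φ : ℕ → X → E, (∀ n, φ n ∈ D) ∧ (∀ n, Measurable (φ n)) ∧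
      ∀ ψ ∈ D, ∀ᵐ x ∂μ, ψ x ∈ closure (range fun n => φ n x) := by
  have h1 : ∀ φ ∈ D, MemLp φ 1 μ := fun φ hφ => (hD.memLp φ hφ).mono_exponent hp
  let S : Set (Lp E 1 μ) := {u | (u : X → E) ∈ D}
  have hS : ∀ φ (hφ : φ ∈ D), (h1 φ hφ).toLp φ ∈ S := fun φ hφ =>
    hD.congr hφ (h1 φ hφ).coeFn_toLp.symm
  have : Fact ((1 : ℝ≥0∞) ≠ ∞) := ⟨ENNReal.one_ne_top⟩
  have : Nonempty S := by
    obtain ⟨φ, hφ⟩ := hne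
    exact ⟨⟨_, hS φ hφ⟩⟩
  -- `L¹` is separable since the σ-algebra is countably generated, hence so is its subset `S`.
  -- Density in `L¹` becomes pointwise almost everywhere along a subsequence.
  let u : ℕ → S := TopologicalSpace.denseSeq S
  refine ⟨fun n => (u n : Lp E 1 μ), fun n => (u n).2,
    fun n => (Lp.stronglyMeasurable _).measurable, fun ψ hψ => ?_⟩
  have hd : (⟨_, hS ψ hψ⟩ : S) ∈ closure (range u) :=
    TopologicalSpace.denseRange_denseSeq S _
  obtain ⟨v, hv, hlim⟩ := mem_closure_iff_seq_limit.1 hd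
  have hlim' := (continuous_subtype_val.tendsto _).comp hlim
  have hmeasure := tendstoInMeasure_of_tendsto_Lp hlim'
  obtain ⟨ns, -, hns⟩ := hmeasure.exists_seq_tendsto_ae
  have hv' : ∀ n, ∃ k, v n = u k := fun n => by
    obtain ⟨k, hk⟩ := hv n
    exact ⟨k, hk.symm⟩
  filter_upwards [hns, (h1 ψ hψ).coeFn_toLp] with x hx hx'
  rw [hx'] at hx
  refine mem_closure_of_tendsto hx (Eventually.of_forall fun n => ?_)
  obtain ⟨k, hk⟩ := hv' (ns n)
  refine ⟨k, ?_⟩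
  simp only [Function.comp, hk]

/-- Rational weights keep the conditions countable, so that they can hold simultaneously almost
everywhere; density of the rationals and continuity recover real weights. -/
lemma convex_closure_of_rat {F : Type*} [NormedAddCommGroup F] [NormedSpace ℝ F] {s : Set F}
    (h : ∀ x ∈ s, ∀ y ∈ s, ∀ q : ℚ, 0 ≤ (q : ℝ) → (q : ℝ) ≤ 1 →
      (1 - (q : ℝ)) • x + (q : ℝ) • y ∈ closure s) : Convex ℝ (closure s) := by
  have hs : ∀ x ∈ s, ∀ y ∈ s, ∀ r ∈ Icc (0 : ℝ) 1, (1 - r) • x + r • y ∈ closure s := by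
    intro x hx y hy r hr
    have hcl : IsClosed {r : ℝ | (1 - r) • x + r • y ∈ closure s} :=
      isClosed_closure.preimage (by fun_prop)
    have hmem : Icc (0 : ℝ) 1 ⊆ closure (Ioo 0 1 ∩ range ((↑) : ℚ → ℝ)) := by
      rw [← closure_Ioo (zero_ne_one' ℝ)]
      exact closure_minimal (Rat.denseRange_cast.open_subset_closure_inter isOpen_Ioo) isClosed_closure
    refine hcl.closure_subset_iff.2 ?_ (hmem hr)
    rintro _ ⟨hq, q, rfl⟩
    exact h x hx y hy q hq.1.le hq.2.le
  rw [convex_iff_forall_pos]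
  intro x hx y hy a b ha hb hab
  obtain rfl : a = 1 - b := by linarith
  have h' : (1 - b) • x + b • y ∈ closure (closure s) :=
    map_mem_closure₂ (f := fun x y => (1 - b) • x + b • y) (by fun_prop) hx hy
      fun x hx y hy => hs x hx y hy b ⟨hb.le, by linarith⟩
  rwa [closure_closure] at h'

/-- Hiai-Umegaki: a convex, decomposable, closed and bounded set of `L^p` functions is the set of
`L^p` selections of an integrably bounded set-valued function with compact convex values. -/
theorem exists_setValued_of_decomposable [IsFiniteMeasure μ]
    [MeasurableSpace.CountablyGenerated X] [NormedSpace ℝ E] [ProperSpace E] [MeasurableSpace E]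
    [BorelSpace E] [SecondCountableTopology E] {p : ℝ} (hp : 1 ≤ p)
    (hD : IsL1Closed μ (ENNReal.ofReal p) D) (hne : D.Nonempty) (hconv : Convex ℝ D)
    (hdec : ∀ A, MeasurableSet A → DecomposableAlong D A) {C : ℝ≥0}
    (hC : ∀ ψ ∈ D, ∫⁻ x, ‖ψ x‖ₑ ^ p ∂μ ≤ C) :
    ∃ Φ : X → Set E, (∀ x, (Φ x).Nonempty ∧ IsCompact (Φ x) ∧ Convex ℝ (Φ x)) ∧
      (∀ U, IsOpen U → MeasurableSet {x | (Φ x ∩ U).Nonempty}) ∧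
      (∃ g : X → ℝ, MemLp g (ENNReal.ofReal p) μ ∧ ∀ᵐ x ∂μ, ∀ y ∈ Φ x, ‖y‖ ≤ g x) ∧
      ∀ ψ, ψ ∈ D ↔ MemLp ψ (ENNReal.ofReal p) μ ∧ ∀ᵐ x ∂μ, ψ x ∈ Φ x := by
  classical
  have hp0 : 0 < p := by linarith
  have hp1 : 1 ≤ ENNReal.ofReal p := by simpa using ENNReal.ofReal_le_ofReal hp
  obtain ⟨φ, hφ, hφm, hφcl⟩ := hD.exists_seq_ae_mem_closure hp1 hne
  have hsup := lintegral_iSup_enorm_rpow_le hp0 hdec hφ hφm hC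
  have hsupm : Measurable fun x => ⨆ n, ‖φ n x‖ₑ := Measurable.iSup fun n => (hφm n).enorm
  have hfin : ∀ᵐ x ∂μ, ⨆ n, ‖φ n x‖ₑ < ∞ := by
    filter_upwards [ae_lt_top (hsupm.pow_const p) (hsup.trans_lt ENNReal.coe_lt_top).ne] with x hx
    exact (ENNReal.rpow_lt_top_iff_of_pos hp0).1 hx
  have hrat : ∀ᵐ x ∂μ, ∀ m n, ∀ q : ℚ, 0 ≤ (q : ℝ) → (q : ℝ) ≤ 1 →
      (1 - (q : ℝ)) • φ m x + (q : ℝ) • φ n x ∈ closure (range fun n => φ n x) := by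
    refine ae_all_iff.2 fun m => ae_all_iff.2 fun n => ae_all_iff.2 fun q => ?_
    by_cases hq : 0 ≤ (q : ℝ) ∧ (q : ℝ) ≤ 1
    · filter_upwards [hφcl _ (hconv (hφ m) (hφ n) (sub_nonneg.2 hq.2) hq.1 (by ring))]
        with x hx _ _ using hx
    · exact Eventually.of_forall fun x h0 h1 => absurd ⟨h0, h1⟩ hq
  -- Off the measurable full-measure set `G`, `Φ` is set to `{0}`, so that its values are compact
  -- and convex everywhere and its measurability is unaffected.
  obtain ⟨G, hGae, hGm, hG⟩ := (hfin.and hrat).exists_measurable_mem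
  have hnorm : ∀ x ∈ G, ∀ y ∈ closure (range fun n => φ n x), ‖y‖ ≤ (⨆ n, ‖φ n x‖ₑ).toReal := by
    intro x hx y hy
    refine closure_minimal (t := {y | ‖y‖ ≤ (⨆ n, ‖φ n x‖ₑ).toReal}) ?_
      (isClosed_le continuous_norm continuous_const) hy
    rintro _ ⟨n, rfl⟩
    rw [mem_ofPred_eq, ← toReal_enorm]
    exact ENNReal.toReal_mono (hG x hx).1.ne (le_iSup (fun n => ‖φ n x‖ₑ) n)
  have hΦ : ∀ x ∈ G, (if x ∈ G then closure (range fun n => φ n x) else {0}) =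
      closure (range fun n => φ n x) := fun x hx => if_pos hx
  refine ⟨fun x => if x ∈ G then closure (range fun n => φ n x) else {0}, fun x => ?_,
    fun U hU => ?_, ⟨fun x => (⨆ n, ‖φ n x‖ₑ).toReal, ?_, ?_⟩, fun ψ => ⟨fun hψ => ?_, ?_⟩⟩
  · by_cases hx : x ∈ G
    · simp only [hΦ x hx]
      refine ⟨(range_nonempty _).closure, ?_, convex_closure_of_rat ?_⟩
      · refine Metric.isCompact_of_isClosed_isBounded isClosed_closure ?_
        exact isBounded_iff_forall_norm_le.2 ⟨_, hnorm x hx⟩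
      · rintro _ ⟨m, rfl⟩ _ ⟨n, rfl⟩ q hq0 hq1
        exact (hG x hx).2 m n q hq0 hq1
    · simp only [if_neg hx]
      exact ⟨singleton_nonempty _, isCompact_singleton, convex_singleton _⟩
  · have e : {x | ((if x ∈ G then closure (range fun n => φ n x) else {0}) ∩ U).Nonempty} =
        (G ∩ ⋃ n, φ n ⁻¹' U) ∪ (Gᶜ ∩ {_x | (0 : E) ∈ U}) := by
      ext x
      by_cases hx : x ∈ G
      · rw [mem_ofPred_eq, hΦ x hx, closure_inter_open_nonempty_iff hU]
        simp only [mem_union, mem_inter_iff, hx, mem_compl_iff, not_true, false_and, or_false,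
          true_and, mem_iUnion, mem_preimage]
        constructor
        · rintro ⟨_, ⟨n, rfl⟩, h⟩; exact ⟨n, h⟩
        · rintro ⟨n, h⟩; exact ⟨_, ⟨n, rfl⟩, h⟩
      · simp [hx]
    rw [e]
    exact (hGm.inter (.iUnion fun n => hφm n hU.measurableSet)).union
      (hGm.compl.inter (.const _))
  · refine memLp_ofReal_of_lintegral_rpow_lt_top hp hsupm.ennreal_toReal.aestronglyMeasurable
      (lt_of_le_of_lt (lintegral_mono fun x => ?_) (hsup.trans_lt ENNReal.coe_lt_top))
    refine ENNReal.rpow_le_rpow ?_ hp0.le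
    rw [Real.enorm_of_nonneg ENNReal.toReal_nonneg]
    exact ENNReal.ofReal_toReal_le
  · filter_upwards [hGae] with x hx y hy
    rw [hΦ x hx] at hy
    exact hnorm x hx y hy
  · refine ⟨hD.memLp ψ hψ, ?_⟩
    filter_upwards [hGae, hφcl ψ hψ] with x hx h
    rwa [hΦ x hx]
  · rintro ⟨hψ, h⟩
    refine hD.mem_of_ae_mem_closure hp1 hdec hφ hφm hψ ?_
    filter_upwards [hGae, h] with x hx h
    rwa [hΦ x hx] at h

/-! ### Properties of `R` transferred to its derivatives -/

/-- The `L^p` functions whose primitive starting at `x₀` belongs to `R`. -/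
def derivativeSet {T : ℝ} {E : Type*} [NormedAddCommGroup E] [NormedSpace ℝ E] (p : ℝ) (x₀ : E)
    (R : Set (Icc (0 : ℝ) T → E)) : Set (Icc (0 : ℝ) T → E) :=
  {φ | MemLp φ (ENNReal.ofReal p) (leb T) ∧ (fun t => x₀ + primitive φ t) ∈ R}

section DerivativeSet

variable {T p : ℝ} {E : Type*} [NormedAddCommGroup E] [NormedSpace ℝ E]
  {R : Set (Icc (0 : ℝ) T → E)} {x₀ : E}

/-- The sup distance of two primitives is at most the `L¹` distance of the integrands; the limit
being in `L^p` puts its primitive in `BV`, where `R` is closed. -/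
lemma isL1Closed_derivativeSet (hp : 1 ≤ p) (hclosed : IsSupClosed p R) :
    IsL1Closed (leb T) (ENNReal.ofReal p) (derivativeSet p x₀ R) := by
  have hp1 : 1 ≤ ENNReal.ofReal p := by simpa using ENNReal.ofReal_le_ofReal hp
  refine ⟨fun φ hφ => hφ.1, fun φ hφ happ => ⟨hφ, hclosed _ (const_add_primitive_mem_BV hp hφ x₀)
    fun ε hε => ?_⟩⟩
  obtain ⟨ψ, hψ, hlt⟩ := happ ε hε
  exact ⟨_, hψ.2, (supNorm_primitive_sub_le (hφ.integrable hp1) (hψ.1.integrable hp1) x₀).trans_lt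
    hlt⟩

lemma convex_derivativeSet (hp : 1 ≤ p) (hconv : Convex ℝ R) :
    Convex ℝ (derivativeSet p x₀ R) := by
  have hp1 : 1 ≤ ENNReal.ofReal p := by simpa using ENNReal.ofReal_le_ofReal hp
  intro φ hφ ψ hψ a b ha hb hab
  refine ⟨(hφ.1.const_smul a).add (hψ.1.const_smul b), ?_⟩
  convert! hconv hφ.2 hψ.2 ha hb hab using 1
  ext1 t
  have h1 := (hφ.1.integrable hp1).integrableOn (s := Iic t)
  have h2 := (hψ.1.integrable hp1).integrableOn (s := Iic t)
  have h : primitive (a • φ + b • ψ) t = a • primitive φ t + b • primitive ψ t := by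
    refine (integral_add (h1.smul a) (h2.smul b)).trans ?_
    simp only [Pi.smul_apply, integral_smul, primitive]
  simp only [Pi.add_apply, Pi.smul_apply, h, smul_add]
  conv_lhs => rw [← one_smul ℝ x₀, ← hab, add_smul]
  abel

/-- By Lebesgue differentiation the derivatives inside `concat` are `φ` and `ψ` almost everywhere,
so `concat` is the primitive of their mixture. -/
lemma decomposableAlong_derivativeSet_Iio [CompleteSpace E] (hT : 0 ≤ T) (hp : 1 ≤ p)
    (hx₀ : ∀ f ∈ R, f ⟨0, left_mem_Icc.2 hT⟩ = x₀) (hdec : IsDecomposable hT R)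
    (a : Icc (0 : ℝ) T) : DecomposableAlong (derivativeSet p x₀ R) (Iio a) := by
  have hp1 : 1 ≤ ENNReal.ofReal p := by simpa using ENNReal.ofReal_le_ofReal hp
  intro φ hφ ψ hψ
  refine ⟨(hφ.1.restrict _).piecewise measurableSet_Iio (hψ.1.restrict _), ?_⟩
  convert! hdec _ hφ.2 _ hψ.2 a using 1
  ext1 t
  rw [concat, hx₀ _ hφ.2]
  congr 1
  refine congrFun (primitive_congr ?_) t
  filter_upwards [derivative_const_add_primitive hT (hφ.1.integrable hp1) x₀,
    derivative_const_add_primitive hT (hψ.1.integrable hp1) x₀] with s h1 h2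
  rcases lt_or_ge s a with h | h
  · simp [h, h1]
  · simp [h, h2]

end DerivativeSet

lemma variation_le_of_bvNorm_le {T p : ℝ} {E : Type*} [NormedAddCommGroup E] (hp : 1 ≤ p)
    {f : Icc (0 : ℝ) T → E} {C : ℝ≥0} (h : bvNorm p f ≤ C) : variation p f ≤ (C ^ p : ℝ≥0) := by
  have hp0 : 0 < p := by linarith
  have h1 : variation p f ^ (1 / p) ≤ C := le_add_self.trans h
  rw [one_div, ENNReal.rpow_inv_le_iff hp0] at h1
  rwa [ENNReal.coe_rpow_of_nonneg _ hp0.le]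

end RieszBV

/-! ### The main theorem -/

theorem theorem2 (d : ℕ) (T p : ℝ) (hT : 0 < T) (hp : 1 ≤ p)
    (R : Set (Icc (0 : ℝ) T → EuclideanSpace ℝ (Fin d)))
    (x₀ : EuclideanSpace ℝ (Fin d))
    (hBV : R ⊆ RieszBV.BV T p (EuclideanSpace ℝ (Fin d)))
    (hAC : p = 1 → ∀ f ∈ R, RieszBV.IsAbsolutelyContinuous hT.le f)
    (hx₀ : (fun f => f ⟨0, left_mem_Icc.2 hT.le⟩) '' R = {x₀})
    (hbdd : RieszBV.IsBoundedBV p R)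
    (hdec : RieszBV.IsDecomposable hT.le R)
    (hconv : Convex ℝ R)
    (hclosed : RieszBV.IsSupClosed p R) :
    ∃ Φ : Icc (0 : ℝ) T → Set (EuclideanSpace ℝ (Fin d)),
      RieszBV.IsConvValued Φ ∧ RieszBV.IsMeasurableSetValued Φ ∧
        RieszBV.IsIntegrablyBounded p Φ ∧ R = RieszBV.setIntegral p x₀ Φ := by
  open RieszBV in
  have hp1 : 1 ≤ ENNReal.ofReal p := by simpa using ENNReal.ofReal_le_ofReal hp
  have hac : ∀ f ∈ R, IsAbsolutelyContinuous hT.le f := by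
    intro f hf
    rcases hp.eq_or_lt with h | h
    · exact hAC h.symm f hf
    · exact absolutelyContinuous_of_variation_lt_top hT.le h (hBV hf)
  have hstart : ∀ f ∈ R, f ⟨0, left_mem_Icc.2 hT.le⟩ = x₀ := fun f hf =>
    mem_singleton_iff.1 (hx₀ ▸ mem_image_of_mem (fun f => f ⟨0, left_mem_Icc.2 hT.le⟩) hf)
  have hmem : ∀ f ∈ R, MemLp (derivative hT.le f) (ENNReal.ofReal p) (leb T) := fun f hf =>
    memLp_derivative hT.le hp (hBV hf) (hac f hf)
  have hrepr : ∀ f ∈ R, f = fun t => x₀ + primitive (derivative hT.le f) t := by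
    intro f hf
    ext1 t
    have h := eq_add_primitive_derivative hT.le (hac f hf) ((hmem f hf).integrable hp1) t
    rwa [hstart f hf] at h
  have hderiv : ∀ f ∈ R, derivative hT.le f ∈ derivativeSet p x₀ R := fun f hf =>
    ⟨hmem f hf, hrepr f hf ▸ hf⟩
  have hne : (derivativeSet p x₀ R).Nonempty := by
    obtain ⟨f, hf, -⟩ : x₀ ∈ (fun f => f ⟨0, left_mem_Icc.2 hT.le⟩) '' R := hx₀ ▸ rfl
    exact ⟨_, hderiv f hf⟩
  obtain ⟨C, hC⟩ := hbdd
  -- Riesz's bound applied to the primitive of `φ`, whose derivative is `φ` almost everywhere.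
  have hbound : ∀ φ ∈ derivativeSet p x₀ R, ∫⁻ s, ‖φ s‖ₑ ^ p ∂(leb T) ≤ (C ^ p : ℝ≥0) := by
    intro φ hφ
    refine le_trans (le_of_eq (lintegral_congr_ae ?_))
      ((lintegral_derivative_rpow_le hT.le hp (hBV hφ.2) (hac _ hφ.2)).trans
        (variation_le_of_bvNorm_le hp (hC _ hφ.2)))
    filter_upwards [derivative_const_add_primitive hT.le (hφ.1.integrable hp1) x₀] with s hs
    rw [hs]
  have hD := isL1Closed_derivativeSet (x₀ := x₀) hp hclosed
  obtain ⟨Φ, hΦ, hΦm, hΦb, hΦD⟩ := exists_setValued_of_decomposable hp hD hne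
    (convex_derivativeSet hp hconv)
    (fun A hA => hD.decomposableAlong_of_Iio hp1
      (decomposableAlong_derivativeSet_Iio hT.le hp hstart hdec) hA) hbound
  refine ⟨Φ, hΦ, hΦm, hΦb, Subset.antisymm (fun f hf => ?_) ?_⟩
  · refine ⟨hBV hf, (hmem f hf).toLp _, ?_, fun t => ?_⟩
    · filter_upwards [(hmem f hf).coeFn_toLp, ((hΦD _).1 (hderiv f hf)).2] with s h1 h2
      rwa [h1]
    · rw [primitive_congr (hmem f hf).coeFn_toLp]
      exact congrFun (hrepr f hf) t
  · rintro f ⟨-, φ, hφ, hf⟩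
    rw [funext hf]
    exact ((hΦD φ).2 ⟨Lp.memLp φ, hφ⟩).2
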